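/- **Setting.** Let $\Sigma=(A,G,\alpha,\sigma)$ be a twisted unital discrete $C^*$-dynamical system: $A$ is a unital $C^*$-algebra, $G$ a discrete group with identity $e$, and $\alpha:G\to\mathrm{Aut}(A)$, $\sigma:G\times G\to\mathcal U(A)$ are maps with $$\alpha_g\circ\alpha_h=\mathrm{Ad}(\sigma(g,h))\circ\alpha_{gh},\qquad \sigma(g,h)\,\sigma(gh,k)=\alpha_g(\sigma(h,k))\,\sigma(g,hk),\qquad \sigma(g,e)=\sigma(e,g)=1$$ for all $g,h,k\in G$. Let $A$ act faithfully (and unitally) on a Hilbert space $\mathcal H$. On $\ell^2(G,\mathcal H)$ put $$(\pi(a)\xi)(h)=\alpha_{h^{-1}}(a)\,\xi(h),\qquad(\lambda(g)\xi)(h)=\sigma(h^{-1},g)\,\xi(g^{-1}h)\qquad(a\in A,\ g,h\in G).$$ The reduced crossed product $C_r^*(\Sigma)$ is the $C^*$-algebra generated by $\pi(A)$ and the unitaries $\lambda(g)$, $g\in G$. Identify $A$ with $\pi(A)$, and let $E:C_r^*(\Sigma)\to A$ be the canonical conditional expectation, determined by continuity and linearity by $E(\pi(a)\lambda(g))=a$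 if $g=e$ and $0$ otherwise. Let $\mathcal U_\Sigma$ be the unitary group of $C_r^*(\Sigma)$ and $\mathcal U_G$ its subgroup generated by the unitaries $\lambda(g)$, $g\in G$. $\Sigma$ has *property (DP)* if $$0\in\overline{\mathrm{co}\{v\,y\,v^*\mid v\in\mathcal U_\Sigma\}}^{\,\|\cdot\|}\qquad\text{for every } y=y^*\in C_r^*(\Sigma)\text{ with }E(y)=0,$$ and the *strong form of property (DP)* if the same holds with $\mathcal U_G$ in place of $\mathcal U_\Sigma$. **The class $\mathcal P$.** For $T\subseteq G$ and $\emptyset\ne M\subseteq G\setminus\{e\}$, $T$ is *$M$-large* if $m(G\setminus T)\subseteq T$ for all $m\in M$. A subset $H\subseteq G$ is a *Powers set* for $\emptyset\ne F\subseteq G\setminus\{e\}$ if for every $N\in\mathbb N$ there are $h_1,\dots,h_N\in H$ and pairwise disjoint $T_1,\dots,T_N\subseteq G$ such that $T_j$ is $h_jFh_j^{-1}$-large for every $j$. It is a *c-Powers set* for $g\in G\setminus\{e\}$ if it is a Powers set for $\{mgm^{-1}\mid m\in M\}$ for every finite nonempty $M\subseteq H$. The group $G$ is a *PH group* if every finite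 nonempty $F\subseteq G\setminus\{e\}$ can be written as $F=\{f_1,\dots,f_n\}$ so that there are subgroups $G_1\subseteq\cdots\subseteq G_n$ of $G$ with $G_j$ a c-Powers set for $f_j$, $j=1,\dots,n$. The group $G$ has *property $(P_{\rm com})$* if for every finite nonempty $F\subseteq G\setminus\{e\}$ there are $n\in\mathbb N$, $g_0\in G$ and $U,D_1,\dots,D_n\subseteq G$ with $G\setminus U\subseteq D_1\cup\dots\cup D_n$; $gU\cap U=\emptyset$ for all $g\in F$; and $g_0^{-j}D_k\cap D_k=\emptyset$ for all integers $j\ge1$ and $k=1,\dots,n$. Let $\mathcal P$ be the class of groups that are PH groups or have property $(P_{\rm com})$. **Theorem.** If $G\in\mathcal P$, then every twisted unital discrete $C^*$-dynamical system $\Sigma=(A,G,\alpha,\sigma)$ over $G$ has property (DP), and indeed its strong form: for every self-adjoint $y\in C_r^*(\Sigma)$ with $E(y)=0$, $$0\in\overline{\mathrm{co}\{v\,y\,v^*\mid v\in\mathcal U_G\}}^{\,\|\cdot\|}.$$ -/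

import Mathlib

/-!
Twisted unital discrete C*-dynamical systems, their reduced crossed products in a regular
representation, the canonical conditional expectation, property (DP) and its strong form,
and the classes of PH groups and of groups with property (P_com).
-/

/-! ### Group-theoretic notions -/

section GroupNotions

variable {G : Type*} [Group G]

/-- The set `⟨g⟩_M = {m g m⁻¹ | m ∈ M}` of conjugates of `g` by elements of `M`. -/
def conjugatesBy (g : G) (M : Set G) : Set G := {x | ∃ m ∈ M, x = m * g * m⁻¹}

/-- `T` is `M`-large in `G`: `m (G \ T) ⊆ T` for all `m ∈ M`. -/
def IsLargeFor (M T : Set G) : Prop := ∀ m ∈ M, ∀ x, x ∉ T → m * x ∈ T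

/-- `S` is a Powers set for `F`: for every `N` there are `h₁, …, h_N ∈ S` and pairwise disjoint
subsets `T₁, …, T_N` of `G` such that `T_j` is `h_j F h_j⁻¹`-large for every `j`. -/
def IsPowersSet (S F : Set G) : Prop :=
  ∀ N : ℕ, ∃ (h : Fin N → G) (T : Fin N → Set G),
    (∀ j, h j ∈ S) ∧ Pairwise (fun i j => Disjoint (T i) (T j)) ∧
      ∀ j, IsLargeFor {x | ∃ f ∈ F, x = h j * f * (h j)⁻¹} (T j)

/-- `S` is a c-Powers set for `g`: it is a Powers set for `⟨g⟩_M` for every finite nonempty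
`M ⊆ S`. -/
def IsCPowersSet (S : Set G) (g : G) : Prop :=
  ∀ M : Set G, M.Finite → M.Nonempty → M ⊆ S → IsPowersSet S (conjugatesBy g M)

variable (G)

/-- `G` is a PH group: every finite nonempty `F ⊆ G \ {e}` can be written as `{f₁, …, f_n}` in such
a way that there are subgroups `G₁ ⊆ ⋯ ⊆ G_n` of `G` with `G_j` a c-Powers set for `f_j`. -/
def IsPHGroup : Prop :=
  ∀ F : Set G, F.Finite → F.Nonempty → (1 : G) ∉ F →
    ∃ (n : ℕ) (f : Fin n → G) (K : Fin n → Subgroup G),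
      Set.range f = F ∧ Monotone K ∧ ∀ j, IsCPowersSet (K j : Set G) (f j)

/-- Property (P_com). -/
def HasPCom : Prop :=
  ∀ F : Set G, F.Finite → F.Nonempty → (1 : G) ∉ F →
    ∃ (n : ℕ) (g₀ : G) (U : Set G) (D : Fin n → Set G),
      (∀ x, x ∉ U → ∃ k, x ∈ D k) ∧
      (∀ g ∈ F, ∀ x ∈ U, g * x ∉ U) ∧
      ∀ j : ℕ, 1 ≤ j → ∀ k, ∀ x ∈ D k, (g₀ ^ j)⁻¹ * x ∉ D k

end GroupNotions

/-! ### Twisted systems and reduced crossed products -/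

/-- A twisted action `(α, σ)` of the discrete group `G` on the unital C*-algebra `A`; together with
`A` and `G` this is a twisted unital discrete C*-dynamical system. -/
structure TwistedAction (A G : Type*) [CStarAlgebra A] [Group G] where
  /-- the automorphisms -/
  α : G → (A ≃⋆ₐ[ℂ] A)
  /-- the cocycle -/
  σ : G → G → unitary A
  α_comp : ∀ g h a, α g (α h a) = (σ g h : A) * α (g * h) a * star (σ g h : A)
  cocycle : ∀ g h k, (σ g h : A) * (σ (g * h) k : A) = α g (σ h k : A) * (σ g (h * k) : A)
  σ_one_right : ∀ g, σ g 1 = 1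
  σ_one_left : ∀ g, σ 1 g = 1

/-- An injective unital *-homomorphism of C*-algebras is isometric. -/
theorem StarAlgHom.norm_map_of_injective {A B : Type*} [CStarAlgebra A] [CStarAlgebra B]
    (φ : A →⋆ₐ[ℂ] B) (hφ : Function.Injective φ) (a : A) : ‖φ a‖ = ‖a‖ := by
  have key : ∀ b : A, IsSelfAdjoint b → ‖b‖ ≤ ‖φ b‖ := by
    intro b hb
    have hcont : Continuous φ :=
      AddMonoidHomClass.continuous_of_bound φ 1
        (fun x => by simpa using NonUnitalStarAlgHom.norm_apply_le φ x)
    have hb' : IsSelfAdjoint (φ b) := hb.map φ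
    let f : ℝ → ℝ := fun x => max (-‖φ b‖) (min x ‖φ b‖)
    have hf : Continuous f := by fun_prop
    have h1 : φ (cfc f b) = φ b := by
      rw [show φ (cfc f b) = cfc f (φ b) from
        StarAlgHomClass.map_cfc (R := ℝ) φ f b hf.continuousOn hcont hb hb']
      conv_rhs => rw [← cfc_id ℝ (φ b) hb']
      refine cfc_congr fun x hx => ?_
      have hle : ‖x‖ ≤ ‖φ b‖ := by
        rcases subsingleton_or_nontrivial B with hB | hB
        · exact absurd hx (by simp [spectrum.of_subsingleton])
        · exact spectrum.norm_le_norm_of_mem hx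
      rw [Real.norm_eq_abs, abs_le] at hle
      simp [f, min_eq_left hle.2, max_eq_right hle.1]
    rw [← hφ h1]
    conv_rhs => rw [h1]
    refine norm_cfc_le (norm_nonneg _) fun x _ => ?_
    rw [Real.norm_eq_abs, abs_le]
    exact ⟨le_max_left _ _, max_le (by linarith [norm_nonneg (φ b)]) (min_le_right _ _)⟩
  refine le_antisymm (NonUnitalStarAlgHom.norm_apply_le φ a) ?_
  have h := key (star a * a) (IsSelfAdjoint.star_mul_self a)
  rw [map_mul, map_star, CStarRing.norm_star_mul_self, CStarRing.norm_star_mul_self] at h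
  exact le_of_sq_le_sq (by simpa [sq] using h) (norm_nonneg _)

namespace TwistedAction

noncomputable section

set_option linter.unusedSectionVars false

variable {A G H : Type*} [CStarAlgebra A] [Group G]
  [NormedAddCommGroup H] [InnerProductSpace ℂ H] [CompleteSpace H]

/-- The Hilbert space `ℓ²(G, H)`. -/
abbrev L2 (G H : Type*) [NormedAddCommGroup H] : Type _ := lp (fun _ : G => H) 2

theorem norm_ρ_apply_le (ρ : A →⋆ₐ[ℂ] (H →L[ℂ] H)) (a : A) (v : H) : ‖ρ a v‖ ≤ ‖a‖ * ‖v‖ :=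
  ((ρ a).le_opNorm v).trans
    (mul_le_mul_of_nonneg_right (NonUnitalStarAlgHom.norm_apply_le ρ a) (norm_nonneg v))

theorem summable_sq_norm (ξ : L2 G H) : Summable fun h => ‖ξ h‖ ^ 2 := by
  have := (lp.memℓp ξ).summable (by norm_num)
  simpa using this

theorem sq_norm_eq_tsum (ξ : L2 G H) : ‖ξ‖ ^ 2 = ∑' h, ‖ξ h‖ ^ 2 := by
  have := lp.norm_rpow_eq_tsum (p := 2) (by norm_num) ξ
  simpa using this

theorem sq_norm_weighted_le (ρ : A →⋆ₐ[ℂ] (H →L[ℂ] H)) (F : G → A) (C : ℝ)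
    (hF : ∀ h, ‖F h‖ ≤ C) (e : G ≃ G) (ξ : L2 G H) (h : G) :
    ‖ρ (F h) (ξ (e h))‖ ^ 2 ≤ C ^ 2 * ‖ξ (e h)‖ ^ 2 := by
  rw [← mul_pow]
  refine pow_le_pow_left₀ (norm_nonneg _) ((norm_ρ_apply_le ρ _ _).trans ?_) 2
  exact mul_le_mul_of_nonneg_right (hF h) (norm_nonneg _)

/-- The weighted permutation operator `(T ξ)(h) = ρ (F h) (ξ (e h))` on `ℓ²(G, H)` attached to a
bounded function `F : G → A` and a permutation `e` of `G`. -/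
def weighted (ρ : A →⋆ₐ[ℂ] (H →L[ℂ] H)) (F : G → A) (C : ℝ) (hF : ∀ h, ‖F h‖ ≤ C) (e : G ≃ G) :
    L2 G H →L[ℂ] L2 G H :=
  LinearMap.mkContinuous
    { toFun := fun ξ => ⟨fun h => ρ (F h) (ξ (e h)), memℓp_gen (by
        have hs : Summable fun h => C ^ 2 * ‖ξ (e h)‖ ^ 2 :=
          ((e.summable_iff (f := fun h => ‖ξ h‖ ^ 2)).2 (summable_sq_norm ξ)).mul_left _
        simpa using hs.of_nonneg_of_le (fun h => by positivity)
          (sq_norm_weighted_le ρ F C hF e ξ))⟩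
      map_add' := fun ξ η => by ext h; exact map_add _ _ _
      map_smul' := fun c ξ => by ext h; exact map_smul _ _ _ }
    C (fun ξ => by
      have hC : 0 ≤ C := (norm_nonneg _).trans (hF 1)
      refine le_of_sq_le_sq ?_ (by positivity)
      have hs : Summable fun h => C ^ 2 * ‖ξ (e h)‖ ^ 2 :=
        ((e.summable_iff (f := fun h => ‖ξ h‖ ^ 2)).2 (summable_sq_norm ξ)).mul_left _
      rw [sq_norm_eq_tsum, mul_pow, sq_norm_eq_tsum, ← e.tsum_eq (fun h => ‖ξ h‖ ^ 2),
        ← tsum_mul_left]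
      exact Summable.tsum_le_tsum (sq_norm_weighted_le ρ F C hF e ξ) (summable_sq_norm _) hs)

@[simp]
theorem weighted_apply (ρ : A →⋆ₐ[ℂ] (H →L[ℂ] H)) (F : G → A) (C : ℝ) (hF : ∀ h, ‖F h‖ ≤ C)
    (e : G ≃ G) (ξ : L2 G H) (h : G) : weighted ρ F C hF e ξ h = ρ (F h) (ξ (e h)) := rfl

theorem star_weighted (ρ : A →⋆ₐ[ℂ] (H →L[ℂ] H)) (F : G → A) (C : ℝ) (hF : ∀ h, ‖F h‖ ≤ C)
    (e : G ≃ G) : star (weighted ρ F C hF e) =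
      weighted ρ (fun h => star (F (e.symm h))) C (fun h => by simpa using hF _) e.symm := by
  symm
  rw [ContinuousLinearMap.star_eq_adjoint, ContinuousLinearMap.eq_adjoint_iff]
  intro ξ η
  rw [lp.inner_eq_tsum, lp.inner_eq_tsum, ← e.tsum_eq]
  refine tsum_congr fun h => ?_
  simp only [weighted_apply, e.symm_apply_apply, map_star, ContinuousLinearMap.star_eq_adjoint,
    ContinuousLinearMap.adjoint_inner_left]

variable (S : TwistedAction A G) (ρ : A →⋆ₐ[ℂ] (H →L[ℂ] H))

theorem α_one (a : A) : S.α 1 a = a := by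
  apply (S.α 1).injective
  simpa [S.σ_one_left] using S.α_comp 1 1 a

/-- The operator `(π(a) ξ)(h) = α_{h⁻¹}(a) ξ(h)` on `ℓ²(G, H)`. -/
def piOp (a : A) : L2 G H →L[ℂ] L2 G H :=
  weighted ρ (fun h => S.α h⁻¹ a) ‖a‖ (fun h => (StarAlgEquiv.norm_map (S.α h⁻¹) a).le)
    (Equiv.refl G)

/-- The operator `(λ(g) ξ)(h) = σ(h⁻¹, g) ξ(g⁻¹ h)` on `ℓ²(G, H)`. -/
def lamOp (g : G) : L2 G H →L[ℂ] L2 G H :=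
  weighted ρ (fun h => (S.σ h⁻¹ g : A)) ‖(1 : A)‖
    (fun h => by simpa using (CStarRing.norm_coe_unitary_mul (S.σ h⁻¹ g) (1 : A)).le)
    (Equiv.mulLeft g⁻¹)

@[simp]
theorem piOp_apply (a : A) (ξ : L2 G H) (h : G) : S.piOp ρ a ξ h = ρ (S.α h⁻¹ a) (ξ h) := rfl

@[simp]
theorem lamOp_apply (g : G) (ξ : L2 G H) (h : G) :
    S.lamOp ρ g ξ h = ρ (S.σ h⁻¹ g : A) (ξ (g⁻¹ * h)) := rfl

/-- The regular covariant representation of `A` on `ℓ²(G, H)`. -/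
def piHom : A →⋆ₐ[ℂ] (L2 G H →L[ℂ] L2 G H) where
  toFun := S.piOp ρ
  map_one' := by ext ξ h; simp
  map_mul' a b := by ext ξ h; simp
  map_zero' := by ext ξ h; simp
  map_add' a b := by ext ξ h; simp
  commutes' c := by
    ext ξ h
    simp [Algebra.algebraMap_eq_smul_one]
  map_star' a := by
    rw [piOp, piOp, star_weighted]
    ext ξ h
    simp only [weighted_apply, Equiv.refl_apply, Equiv.refl_symm, map_star]

theorem lamOp_mul (g k : G) :
    S.lamOp ρ g * S.lamOp ρ k = S.piOp ρ (S.σ g k : A) * S.lamOp ρ (g * k) := by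
  ext ξ h
  simp only [mul_apply_eq_comp, lamOp_apply, piOp_apply, mul_inv_rev, inv_inv]
  rw [← mul_apply_eq_comp, ← map_mul, ← mul_apply_eq_comp, ← map_mul,
    S.cocycle, mul_assoc]

theorem lamOp_mul_piOp (g : G) (a : A) :
    S.lamOp ρ g * S.piOp ρ a = S.piOp ρ (S.α g a) * S.lamOp ρ g := by
  ext ξ h
  simp only [mul_apply_eq_comp, lamOp_apply, piOp_apply, mul_inv_rev, inv_inv]
  rw [← mul_apply_eq_comp, ← map_mul, ← mul_apply_eq_comp, ← map_mul,
    S.α_comp, mul_assoc, Unitary.coe_star_mul_self, mul_one]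

theorem lamOp_mem_unitary (g : G) : S.lamOp ρ g ∈ unitary (L2 G H →L[ℂ] L2 G H) := by
  rw [Unitary.mem_iff, lamOp, star_weighted]
  constructor <;> ext ξ h
  · rw [mul_apply_eq_comp, weighted_apply, weighted_apply, ← mul_apply_eq_comp, ← map_mul,
      Unitary.coe_star_mul_self]
    simp
  · rw [mul_apply_eq_comp, weighted_apply, weighted_apply, ← mul_apply_eq_comp, ← map_mul,
      Equiv.symm_apply_apply]
    have hu : (S.σ h⁻¹ g : A) * star (S.σ h⁻¹ g : A) = 1 := Unitary.coe_mul_star_self _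
    rw [hu]
    simp

theorem lamOp_one : S.lamOp ρ 1 = 1 := by
  ext ξ h
  simp [S.σ_one_right]

theorem star_lamOp (g : G) :
    star (S.lamOp ρ g) = S.piOp ρ (star (S.σ g⁻¹ g : A)) * S.lamOp ρ g⁻¹ := by
  have h1 := S.lamOp_mul ρ g⁻¹ g
  rw [inv_mul_cancel, lamOp_one, mul_one] at h1
  have h2 : S.lamOp ρ g⁻¹ = S.piOp ρ (S.σ g⁻¹ g : A) * star (S.lamOp ρ g) := by
    rw [← h1, mul_assoc, (Unitary.mem_iff.1 (S.lamOp_mem_unitary ρ g)).2, mul_one]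
  have h3 : S.piOp ρ (star (S.σ g⁻¹ g : A)) * S.piOp ρ (S.σ g⁻¹ g : A) = 1 := by
    have := (map_mul (S.piHom ρ) (star (S.σ g⁻¹ g : A)) (S.σ g⁻¹ g : A)).symm
    rwa [Unitary.coe_star_mul_self, map_one] at this
  rw [h2, ← mul_assoc, h3, one_mul]

/-- The reduced crossed product `C*_r(Σ)`: the C*-algebra of operators on `ℓ²(G, H)` generated by
the operators `π(a)` and `λ(g)`. It is the reduced crossed product when `ρ` is injective. -/
def redCrossedProduct : StarSubalgebra ℂ (L2 G H →L[ℂ] L2 G H) :=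
  (StarAlgebra.adjoin ℂ (Set.range (S.piOp ρ) ∪ Set.range (S.lamOp ρ))).topologicalClosure

/-- The element `π(a)` of the reduced crossed product. -/
def incl (a : A) : S.redCrossedProduct ρ :=
  ⟨S.piOp ρ a, StarSubalgebra.le_topologicalClosure _
    (StarAlgebra.subset_adjoin ℂ _ (Or.inl ⟨a, rfl⟩))⟩

/-- The unitary `λ(g)` of the reduced crossed product. -/
def lam (g : G) : unitary (S.redCrossedProduct ρ) :=
  ⟨⟨S.lamOp ρ g, StarSubalgebra.le_topologicalClosure _
    (StarAlgebra.subset_adjoin ℂ _ (Or.inr ⟨g, rfl⟩))⟩, by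
    have h := Unitary.mem_iff.1 (S.lamOp_mem_unitary ρ g)
    exact Unitary.mem_iff.2 ⟨Subtype.ext h.1, Subtype.ext h.2⟩⟩

/-- The linear span of the operators `π(a) λ(g)`. -/
def finiteSums : Submodule ℂ (L2 G H →L[ℂ] L2 G H) :=
  Submodule.span ℂ {T | ∃ a g, T = S.piOp ρ a * S.lamOp ρ g}

theorem finiteSums_mul {x y : L2 G H →L[ℂ] L2 G H} (hx : x ∈ S.finiteSums ρ)
    (hy : y ∈ S.finiteSums ρ) : x * y ∈ S.finiteSums ρ := by
  have h := Submodule.mul_mem_mul hx hy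
  rw [finiteSums, Submodule.span_mul_span] at h
  refine Submodule.span_mono ?_ h
  rintro _ ⟨_, ⟨a, g, rfl⟩, _, ⟨b, k, rfl⟩, rfl⟩
  refine ⟨a * S.α g b * (S.σ g k : A), g * k, ?_⟩
  have h1 : ∀ c d, S.piOp ρ (c * d) = S.piOp ρ c * S.piOp ρ d := map_mul (S.piHom ρ)
  simp only [h1]
  rw [mul_assoc, ← mul_assoc (S.lamOp ρ g), lamOp_mul_piOp, mul_assoc (S.piOp ρ _) (S.lamOp ρ g),
    lamOp_mul]
  simp only [mul_assoc]

theorem finiteSums_star {x : L2 G H →L[ℂ] L2 G H} (hx : x ∈ S.finiteSums ρ) :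
    star x ∈ S.finiteSums ρ := by
  induction hx using Submodule.span_induction with
  | mem x hx =>
    obtain ⟨a, g, rfl⟩ := hx
    have h1 : star (S.piOp ρ a) = S.piOp ρ (star a) := (map_star (S.piHom ρ) a).symm
    rw [star_mul, star_lamOp, h1]
    refine S.finiteSums_mul ρ (Submodule.subset_span ⟨_, _, rfl⟩)
      (Submodule.subset_span ⟨star a, 1, ?_⟩)
    rw [lamOp_one, mul_one]
  | zero => simp
  | add x y _ _ hx hy => rw [star_add]; exact add_mem hx hy
  | smul c x _ hx => rw [star_smul]; exact Submodule.smul_mem _ _ hx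

theorem adjoin_subset_finiteSums {x : L2 G H →L[ℂ] L2 G H}
    (hx : x ∈ StarAlgebra.adjoin ℂ (Set.range (S.piOp ρ) ∪ Set.range (S.lamOp ρ))) :
    x ∈ S.finiteSums ρ := by
  have hπ : ∀ a, S.piOp ρ a ∈ S.finiteSums ρ := fun a =>
    Submodule.subset_span ⟨a, 1, by rw [lamOp_one, mul_one]⟩
  have h1 : S.piOp ρ 1 = 1 := map_one (S.piHom ρ)
  induction hx using StarAlgebra.adjoin_induction with
  | mem x hx =>
    rcases hx with ⟨a, rfl⟩ | ⟨g, rfl⟩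
    · exact hπ a
    · exact Submodule.subset_span ⟨1, g, by rw [h1, one_mul]⟩
  | algebraMap r =>
    rw [Algebra.algebraMap_eq_smul_one, ← h1]
    exact Submodule.smul_mem _ _ (hπ 1)
  | add x y _ _ hx hy => exact add_mem hx hy
  | mul x y _ _ hx hy => exact S.finiteSums_mul ρ hx hy
  | star x _ hx => exact S.finiteSums_star ρ hx

open Classical in
/-- The compression `T ↦ V* T V` of operators on `ℓ²(G, H)` to the copy `V : H → ℓ²(G, H)` of `H`
that sits at the identity of `G`. -/
def compress (G H : Type*) [Group G] [NormedAddCommGroup H] [InnerProductSpace ℂ H] :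
    (L2 G H →L[ℂ] L2 G H) →ₗ[ℂ] (H →L[ℂ] H) where
  toFun T := (lp.evalCLM ℂ (fun _ : G => H) 2 1).comp
    (T.comp (lp.singleContinuousLinearMap ℂ (fun _ : G => H) 2 1))
  map_add' T T' := by ext v; simp
  map_smul' c T := by ext v; simp

theorem continuous_compress : Continuous (compress G H) := by
  change Continuous fun T => _
  simp only [compress, LinearMap.coe_mk, AddHom.coe_mk]
  fun_prop

theorem compress_piOp_mul_lamOp (a : A) (g : G) [Decidable (g = 1)] :
    compress G H (S.piOp ρ a * S.lamOp ρ g) = ρ (if g = 1 then a else 0) := by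
  classical
  ext v
  change S.piOp ρ a (S.lamOp ρ g (lp.single 2 1 v)) 1 = _
  rw [piOp_apply, lamOp_apply, lp.single_apply]
  by_cases hg : g = 1
  · subst hg
    simp [S.σ_one_left, S.α_one]
  · simp [hg]

theorem compress_mem_range (hρ : Function.Injective ρ) (x : S.redCrossedProduct ρ) :
    compress G H (x : L2 G H →L[ℂ] L2 G H) ∈ LinearMap.range ρ.toAlgHom.toLinearMap := by
  classical
  have hcl : IsClosed (LinearMap.range ρ.toAlgHom.toLinearMap : Set (H →L[ℂ] H)) := by
    have hiso : Isometry ρ :=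
      AddMonoidHomClass.isometry_of_norm ρ (StarAlgHom.norm_map_of_injective ρ hρ)
    exact hiso.isClosedEmbedding.isClosed_range
  have hx : (x : L2 G H →L[ℂ] L2 G H) ∈ closure
      (StarAlgebra.adjoin ℂ (Set.range (S.piOp ρ) ∪ Set.range (S.lamOp ρ)) :
        Set (L2 G H →L[ℂ] L2 G H)) := x.2
  refine closure_minimal (t := compress G H ⁻¹' _) ?_ (hcl.preimage continuous_compress) hx
  intro y hy
  have hy' := S.adjoin_subset_finiteSums ρ hy
  change compress G H y ∈ LinearMap.range ρ.toAlgHom.toLinearMap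
  clear hy
  induction hy' using Submodule.span_induction with
  | mem y hy =>
    obtain ⟨a, g, rfl⟩ := hy
    rw [compress_piOp_mul_lamOp]
    exact ⟨_, rfl⟩
  | zero => simp
  | add y z _ _ hy hz => rw [map_add]; exact add_mem hy hz
  | smul c y _ hy => rw [map_smul]; exact Submodule.smul_mem _ _ hy

/-- The canonical conditional expectation `E : C*_r(Σ) → A`: `E x` is the unique element of `A`
whose image under `ρ` is the compression of `x` to the copy of `H` at the identity of `G`. -/
def condExp (hρ : Function.Injective ρ) : S.redCrossedProduct ρ →ₗ[ℂ] A :=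
  (LinearEquiv.ofInjective ρ.toAlgHom.toLinearMap hρ).symm.toLinearMap ∘ₗ
    ((compress G H).comp (S.redCrossedProduct ρ).toSubalgebra.toSubmodule.subtype).codRestrict
      (LinearMap.range ρ.toAlgHom.toLinearMap) (S.compress_mem_range ρ hρ)

theorem ρ_condExp (hρ : Function.Injective ρ) (x : S.redCrossedProduct ρ) :
    ρ (S.condExp ρ hρ x) = compress G H (x : L2 G H →L[ℂ] L2 G H) :=
  congrArg Subtype.val ((LinearEquiv.ofInjective ρ.toAlgHom.toLinearMap hρ).apply_symm_apply
    ⟨_, S.compress_mem_range ρ hρ x⟩)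

/-- `E (π(a) λ(g))` is `a` if `g` is the identity and `0` otherwise. -/
theorem condExp_incl_mul_lam (hρ : Function.Injective ρ) (a : A) (g : G) [Decidable (g = 1)] :
    S.condExp ρ hρ (S.incl ρ a * (S.lam ρ g : S.redCrossedProduct ρ)) = if g = 1 then a else 0 := by
  apply hρ
  rw [ρ_condExp, ← compress_piOp_mul_lamOp S]
  rfl

/-- The subgroup `U_G` of the unitary group of `C*_r(Σ)` generated by the unitaries `λ(g)`. -/
def lamGroup : Subgroup (unitary (S.redCrossedProduct ρ)) :=
  Subgroup.closure (Set.range (S.lam ρ))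

/-- Property (DP). -/
def HasDP (hρ : Function.Injective ρ) : Prop :=
  ∀ y : S.redCrossedProduct ρ, star y = y → S.condExp ρ hρ y = 0 →
    (0 : S.redCrossedProduct ρ) ∈ closure (convexHull ℝ
      {x | ∃ v : unitary (S.redCrossedProduct ρ),
        x = (v : S.redCrossedProduct ρ) * y * star (v : S.redCrossedProduct ρ)})

/-- The strong form of property (DP): only unitaries in `U_G` are used. -/
def HasStrongDP (hρ : Function.Injective ρ) : Prop :=
  ∀ y : S.redCrossedProduct ρ, star y = y → S.condExp ρ hρ y = 0 →
    (0 : S.redCrossedProduct ρ) ∈ closure (convexHull ℝ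
      {x | ∃ v ∈ S.lamGroup ρ,
        x = (v : S.redCrossedProduct ρ) * y * star (v : S.redCrossedProduct ρ)})

end

end TwistedAction

namespace TwistedAction

noncomputable section

set_option linter.unusedSectionVars false

variable {A G H : Type*} [CStarAlgebra A] [Group G]
  [NormedAddCommGroup H] [InnerProductSpace ℂ H] [CompleteSpace H]

/-! ### Coordinate projections of `ℓ²(G, H)` -/

/-! The heart is a norm estimate for averages of conjugates. If `x` is a combination of the
operators `π(a) λ(g)` with `g ∈ F`, then `λ(h) x λ(h)*` is supported on `h F h⁻¹`. When `T` is large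
for `h F h⁻¹`, this conjugate has zero compression to the complement of `T`. For `N` such conjugates
whose sets `T_j` overlap at most `K` times, Cauchy–Schwarz bounds the sum by `2 ‖x‖ √(N K)`
(`norm_sum_le_of_corner_eq_zero`), so the average is at most `2 ‖x‖ √(K / N)`, which tends to `0`.

Property (P_com) supplies such sets from the powers of a single element, with `K` independent of
`N`. In a PH group one splits `x` along `f₁, …, f_n` and kills the pieces one after another.
Averaging with elements of a smaller subgroup keeps the later pieces within the scope of the later
c-Powers sets, and averaging never increases norms, so pieces already made small stay small.

An element with `E y = 0` is a norm limit of finite sums without a term at the identity. Since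
averaging maps are contractive, smallness passes from these sums to `y`. -/

open Classical in
/-- The coordinate projection of `ℓ²(G, H)` onto `ℓ²(T, H)`. -/
def restrict (ρ : A →⋆ₐ[ℂ] (H →L[ℂ] H)) (T : Set G) : L2 G H →L[ℂ] L2 G H :=
  weighted ρ (fun h => if h ∈ T then 1 else 0) ‖(1 : A)‖ (fun h => by split_ifs <;> simp)
    (Equiv.refl G)

variable (S : TwistedAction A G) (ρ : A →⋆ₐ[ℂ] (H →L[ℂ] H))

-- Since `ρ` is unital it drops out of the formula; it serves only to present the projection as a
-- weighted permutation operator.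
open Classical in
theorem restrict_apply (T : Set G) (ξ : L2 G H) (h : G) :
    restrict ρ T ξ h = if h ∈ T then ξ h else 0 := by
  rw [restrict, weighted_apply]
  split_ifs <;> simp

theorem inner_restrict (T : Set G) (ξ η : L2 G H) :
    inner ℂ ξ (restrict ρ T η) = inner ℂ (restrict ρ T ξ) η := by
  classical
  rw [lp.inner_eq_tsum, lp.inner_eq_tsum]
  refine tsum_congr fun h => ?_
  rw [restrict_apply, restrict_apply]
  split_ifs <;> simp

theorem restrict_add_restrict_compl (T : Set G) (ξ : L2 G H) :
    restrict ρ T ξ + restrict ρ Tᶜ ξ = ξ := by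
  classical
  ext h
  rw [lp.coeFn_add, Pi.add_apply, restrict_apply, restrict_apply]
  by_cases hT : h ∈ T <;> simp [hT]

-- On the left each `‖ξ h‖ ^ 2` is counted once for every `T j` containing `h`, hence at most `K`
-- times.
open Classical in
theorem sum_sq_norm_restrict_le {ι : Type*} [Fintype ι] (T : ι → Set G) (K : ℕ)
    (hK : ∀ h, (Finset.univ.filter fun j => h ∈ T j).card ≤ K) (ξ : L2 G H) :
    ∑ j, ‖restrict ρ (T j) ξ‖ ^ 2 ≤ K * ‖ξ‖ ^ 2 := by
  simp_rw [sq_norm_eq_tsum]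
  rw [← Summable.tsum_finsetSum fun j _ => summable_sq_norm _, ← tsum_mul_left]
  refine Summable.tsum_le_tsum (fun h => ?_) (summable_sum fun j _ => summable_sq_norm _)
    ((summable_sq_norm ξ).mul_left _)
  have : ∀ j, ‖restrict ρ (T j) ξ h‖ ^ 2 = if h ∈ T j then ‖ξ h‖ ^ 2 else 0 := by
    intro j
    rw [restrict_apply]
    split_ifs <;> simp
  simp_rw [this]
  rw [← Finset.sum_filter, Finset.sum_const, nsmul_eq_mul]
  exact mul_le_mul_of_nonneg_right (by exact_mod_cast hK h) (by positivity)

open Classical in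
theorem sum_norm_restrict_le {ι : Type*} [Fintype ι] (T : ι → Set G) (K : ℕ)
    (hK : ∀ h, (Finset.univ.filter fun j => h ∈ T j).card ≤ K) (ξ : L2 G H) :
    ∑ j, ‖restrict ρ (T j) ξ‖ ≤ √(Fintype.card ι * K) * ‖ξ‖ := by
  refine le_of_sq_le_sq ?_ (by positivity)
  rw [mul_pow, Real.sq_sqrt (by positivity), mul_assoc]
  refine (sq_sum_le_card_mul_sum_sq (s := Finset.univ)).trans ?_
  rw [Finset.card_univ]
  exact mul_le_mul_of_nonneg_left (sum_sq_norm_restrict_le ρ T K hK ξ) (by positivity)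

/-- Splitting both vectors along `T` and its complement, the term with both complementary parts
vanishes, so every surviving term sees `η` or `ξ` only through `T`. This makes the bounds summable
over many sets `T`. -/
theorem norm_inner_apply_le {x : L2 G H →L[ℂ] L2 G H} {T : Set G} {C : ℝ} (hx : ‖x‖ ≤ C)
    (hT : restrict ρ Tᶜ * x * restrict ρ Tᶜ = 0) (ξ η : L2 G H) :
    ‖inner ℂ η (x ξ)‖ ≤ C * (‖restrict ρ T η‖ * ‖ξ‖ + ‖η‖ * ‖restrict ρ T ξ‖) := by
  have hP : ‖restrict ρ Tᶜ η‖ ≤ ‖η‖ := by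
    classical
    have := sum_sq_norm_restrict_le ρ (fun _ : Unit => Tᶜ) 1
      (fun h => by
        convert Finset.card_filter_le _ _
        simp) η
    exact le_of_sq_le_sq (by simpa using this) (norm_nonneg _)
  have h0 : inner ℂ (restrict ρ Tᶜ η) (x (restrict ρ Tᶜ ξ)) = 0 := by
    rw [← inner_restrict]
    have := congrArg (fun f => f ξ) hT
    simp only [mul_apply_eq_comp] at this
    rw [this]
    simp
  have hsplit : inner ℂ η (x ξ) = inner ℂ (restrict ρ T η) (x ξ) +
      inner ℂ (restrict ρ Tᶜ η) (x (restrict ρ T ξ)) := by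
    conv_lhs => rw [← restrict_add_restrict_compl ρ T η, inner_add_left]
    congr 1
    conv_lhs => rw [← restrict_add_restrict_compl ρ T ξ, map_add, inner_add_right, h0, add_zero]
  have hxn : ∀ ζ, ‖x ζ‖ ≤ C * ‖ζ‖ := fun ζ => x.le_of_opNorm_le hx ζ
  rw [hsplit]
  calc _ ≤ ‖restrict ρ T η‖ * (C * ‖ξ‖) + ‖η‖ * (C * ‖restrict ρ T ξ‖) := by
        refine (norm_add_le _ _).trans (add_le_add ?_ ?_)
        · exact (norm_inner_le_norm _ _).trans
            (mul_le_mul_of_nonneg_left (hxn _) (norm_nonneg _))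
        · exact (norm_inner_le_norm _ _).trans
            (mul_le_mul hP (hxn _) (norm_nonneg _) (norm_nonneg _))
    _ = _ := by ring

open Classical in
/-- Operators that are nearly orthogonal, in the sense that `x j` vanishes off the corner given by
`T j` and no point of `G` lies in more than `K` of the sets `T j`, have a sum of norm
`O(√N)`. -/
theorem norm_sum_le_of_corner_eq_zero {ι : Type*} [Fintype ι] (x : ι → (L2 G H →L[ℂ] L2 G H))
    (T : ι → Set G) {C : ℝ} {K : ℕ} (hx : ∀ j, ‖x j‖ ≤ C) (hC : 0 ≤ C)
    (hT : ∀ j, restrict ρ (T j)ᶜ * x j * restrict ρ (T j)ᶜ = 0)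
    (hK : ∀ h, (Finset.univ.filter fun j => h ∈ T j).card ≤ K) :
    ‖∑ j, x j‖ ≤ 2 * C * √(Fintype.card ι * K) := by
  refine ContinuousLinearMap.opNorm_le_bound _ (by positivity) fun ξ => ?_
  set η := (∑ j, x j) ξ with hη
  set s := √(Fintype.card ι * K)
  -- The image vector is paired with itself; one factor `‖η‖` cancels at the end.
  have h1 : ‖η‖ * ‖η‖ ≤ ‖η‖ * (2 * C * s * ‖ξ‖) := by
    calc ‖η‖ * ‖η‖ = ‖inner ℂ η η‖ := by rw [inner_self_eq_norm_sq_to_K]; simp [sq]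
      _ = ‖∑ j, inner ℂ η (x j ξ)‖ := by
        conv_lhs => rw [hη, sum_apply, inner_sum, ← sum_apply, ← hη]
      _ ≤ ∑ j, C * (‖restrict ρ (T j) η‖ * ‖ξ‖ + ‖η‖ * ‖restrict ρ (T j) ξ‖) :=
        (norm_sum_le _ _).trans (Finset.sum_le_sum fun j _ =>
          norm_inner_apply_le ρ (hx j) (hT j) ξ η)
      _ = C * ((∑ j, ‖restrict ρ (T j) η‖) * ‖ξ‖ + ‖η‖ * ∑ j, ‖restrict ρ (T j) ξ‖) := by
        rw [← Finset.mul_sum, Finset.sum_add_distrib, Finset.sum_mul, Finset.mul_sum]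
      _ ≤ C * ((s * ‖η‖) * ‖ξ‖ + ‖η‖ * (s * ‖ξ‖)) := by
        gcongr <;> exact sum_norm_restrict_le ρ T K hK _
      _ = _ := by ring
  rcases (norm_nonneg η).eq_or_lt with h | h
  · rw [← h]; positivity
  · exact le_of_mul_le_mul_left h1 h

/-! ### Operators with prescribed support -/

/-- The linear span of the operators `π(a) λ(g)` with `g ∈ F`. -/
def supportedOn (F : Set G) : Submodule ℂ (L2 G H →L[ℂ] L2 G H) :=
  Submodule.span ℂ {T | ∃ a, ∃ g ∈ F, T = S.piOp ρ a * S.lamOp ρ g}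

variable {S}

theorem supportedOn_mono {F F' : Set G} (h : F ⊆ F') : S.supportedOn ρ F ≤ S.supportedOn ρ F' :=
  Submodule.span_mono fun _ ⟨a, g, hg, e⟩ => ⟨a, g, h hg, e⟩

/-- The operator `π(a) λ(g)` carries vectors supported on `X` to vectors supported on `g X`, which
is disjoint from `X`. -/
theorem restrict_mul_mul_restrict {F X : Set G} (hX : ∀ g ∈ F, ∀ t ∈ X, g * t ∉ X)
    {x : L2 G H →L[ℂ] L2 G H} (hx : x ∈ S.supportedOn ρ F) :
    restrict ρ X * x * restrict ρ X = 0 := by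
  classical
  induction hx using Submodule.span_induction with
  | mem x hx =>
    obtain ⟨a, g, hg, rfl⟩ := hx
    ext ξ h
    simp only [mul_apply_eq_comp, restrict_apply, piOp_apply, lamOp_apply]
    by_cases h1 : h ∈ X
    · have h2 : g⁻¹ * h ∉ X := fun h2 => hX g hg _ h2 (by simpa using h1)
      simp [h2]
    · simp [h1]
  | zero => simp
  | add x y _ _ hx hy => rw [mul_add, add_mul, hx, hy, add_zero]
  | smul c x _ hx => rw [mul_smul_comm, smul_mul_assoc, hx, smul_zero]

/-- The twist affects only the coefficient in `A`; the group element is conjugated as in the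
untwisted case. -/
theorem lamOp_conj (s : G) (a : A) (g : G) :
    S.lamOp ρ s * (S.piOp ρ a * S.lamOp ρ g) * star (S.lamOp ρ s) =
      S.piOp ρ (S.α s a * S.σ s g * star (S.σ (s * g * s⁻¹) s : A)) * S.lamOp ρ (s * g * s⁻¹) := by
  have hm : ∀ c d, S.piOp ρ (c * d) = S.piOp ρ c * S.piOp ρ d := map_mul (S.piHom ρ)
  -- A factor `λ(s)` is split off on the right so that it cancels against `λ(s)*`.
  have h1 : S.lamOp ρ (s * g) = S.piOp ρ (star (S.σ (s * g * s⁻¹) s : A)) *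
      (S.lamOp ρ (s * g * s⁻¹) * S.lamOp ρ s) := by
    rw [lamOp_mul, ← mul_assoc, ← hm, Unitary.coe_star_mul_self, inv_mul_cancel_right]
    exact (one_mul _).symm.trans (congrArg (· * _) (map_one (S.piHom ρ)).symm)
  have h2 : S.lamOp ρ s * star (S.lamOp ρ s) = 1 := (Unitary.mem_iff.1 (S.lamOp_mem_unitary ρ s)).2
  rw [← mul_assoc, lamOp_mul_piOp, mul_assoc (S.piOp ρ _), lamOp_mul, h1, hm, hm]
  simp only [mul_assoc]
  rw [h2, mul_one]

theorem lamOp_conj_mem_supportedOn {F F' : Set G} (s : G) (h : ∀ g ∈ F, s * g * s⁻¹ ∈ F')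
    {x : L2 G H →L[ℂ] L2 G H} (hx : x ∈ S.supportedOn ρ F) :
    S.lamOp ρ s * x * star (S.lamOp ρ s) ∈ S.supportedOn ρ F' := by
  induction hx using Submodule.span_induction with
  | mem x hx =>
    obtain ⟨a, g, hg, rfl⟩ := hx
    rw [lamOp_conj]
    exact Submodule.subset_span ⟨_, _, h g hg, rfl⟩
  | zero => simp
  | add x y _ _ hx hy => rw [mul_add, add_mul]; exact add_mem hx hy
  | smul c x _ hx => rw [mul_smul_comm, smul_mul_assoc]; exact Submodule.smul_mem _ _ hx

/-! ### Averaging maps -/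

variable (S)

/-- The orbit of an operator under conjugation by the unitaries of `U_G`. -/
def lamOrbit (y : L2 G H →L[ℂ] L2 G H) : Set (L2 G H →L[ℂ] L2 G H) :=
  {x | ∃ v ∈ S.lamGroup ρ, x = ((v : S.redCrossedProduct ρ) : L2 G H →L[ℂ] L2 G H) * y *
    star ((v : S.redCrossedProduct ρ) : L2 G H →L[ℂ] L2 G H)}

/-- A linear map that sends every operator into the convex hull of its orbit under `U_G`. -/
def IsAveraging (Φ : (L2 G H →L[ℂ] L2 G H) →ₗ[ℝ] (L2 G H →L[ℂ] L2 G H)) : Prop :=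
  ∀ y, Φ y ∈ convexHull ℝ (S.lamOrbit ρ y)

/-- The conjugation `x ↦ w x w*`, as a real linear map. -/
def conjMap (w : L2 G H →L[ℂ] L2 G H) : (L2 G H →L[ℂ] L2 G H) →ₗ[ℝ] (L2 G H →L[ℂ] L2 G H) :=
  (LinearMap.mulLeftRight ℂ (w, star w)).restrictScalars ℝ

theorem conjMap_apply (w x : L2 G H →L[ℂ] L2 G H) : conjMap w x = w * x * star w := rfl

/-- The average of the conjugates of an operator by `λ(h 0), …, λ(h (N - 1))`. -/
def average {N : ℕ} (h : Fin N → G) :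
    (L2 G H →L[ℂ] L2 G H) →ₗ[ℝ] (L2 G H →L[ℂ] L2 G H) :=
  (N : ℝ)⁻¹ • ∑ j, conjMap (S.lamOp ρ (h j))

theorem average_apply {N : ℕ} (h : Fin N → G) (x : L2 G H →L[ℂ] L2 G H) :
    S.average ρ h x = (N : ℝ)⁻¹ • ∑ j, S.lamOp ρ (h j) * x * star (S.lamOp ρ (h j)) := by
  simp [average, conjMap_apply]

variable {S}

theorem norm_conj_unitary_le (u : unitary (S.redCrossedProduct ρ)) (y : L2 G H →L[ℂ] L2 G H) :
    ‖((u : S.redCrossedProduct ρ) : L2 G H →L[ℂ] L2 G H) * y *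
      star ((u : S.redCrossedProduct ρ) : L2 G H →L[ℂ] L2 G H)‖ ≤ ‖y‖ := by
  have hu : ((u : S.redCrossedProduct ρ) : L2 G H →L[ℂ] L2 G H) ∈
      unitary (L2 G H →L[ℂ] L2 G H) := by
    have h := Unitary.mem_iff.1 u.2
    exact Unitary.mem_iff.2 ⟨congrArg Subtype.val h.1, congrArg Subtype.val h.2⟩
  rw [CStarRing.norm_mul_mem_unitary _ (Unitary.star_mem hu), CStarRing.norm_mem_unitary_mul _ hu]

/-- The orbit of `y` lies in the closed ball of radius `‖y‖`, which is convex. -/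
theorem IsAveraging.norm_apply_le {Φ : (L2 G H →L[ℂ] L2 G H) →ₗ[ℝ] (L2 G H →L[ℂ] L2 G H)}
    (hΦ : S.IsAveraging ρ Φ) (y : L2 G H →L[ℂ] L2 G H) : ‖Φ y‖ ≤ ‖y‖ := by
  have : convexHull ℝ (S.lamOrbit ρ y) ⊆ Metric.closedBall 0 ‖y‖ := by
    refine convexHull_min ?_ (convex_closedBall _ _)
    rintro _ ⟨v, -, rfl⟩
    rw [mem_closedBall_zero_iff]
    exact norm_conj_unitary_le ρ v y
  exact mem_closedBall_zero_iff.1 (this (hΦ y))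

theorem isAveraging_id : S.IsAveraging ρ LinearMap.id := fun y =>
  subset_convexHull ℝ _ ⟨1, one_mem _, by simp⟩

/-- Conjugation is linear, so it commutes with convex hulls, and the orbit of `y` is stable under
conjugation by the group `U_G`. -/
theorem IsAveraging.comp {Φ Ψ : (L2 G H →L[ℂ] L2 G H) →ₗ[ℝ] (L2 G H →L[ℂ] L2 G H)}
    (hΦ : S.IsAveraging ρ Φ) (hΨ : S.IsAveraging ρ Ψ) : S.IsAveraging ρ (Φ ∘ₗ Ψ) := by
  intro y
  refine convexHull_min ?_ (convex_convexHull ℝ _) (hΦ (Ψ y))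
  rintro _ ⟨v, hv, rfl⟩
  set w := ((v : S.redCrossedProduct ρ) : L2 G H →L[ℂ] L2 G H)
  have h1 : conjMap w (Ψ y) ∈
      convexHull ℝ (conjMap w '' S.lamOrbit ρ y) := by
    rw [← LinearMap.image_convexHull]
    exact ⟨_, hΨ y, rfl⟩
  rw [conjMap_apply] at h1
  refine convexHull_mono ?_ h1
  rintro _ ⟨_, ⟨u, hu, rfl⟩, rfl⟩
  refine ⟨v * u, mul_mem hv hu, ?_⟩
  simp [w, conjMap_apply, mul_assoc]

theorem isAveraging_average {N : ℕ} (hN : N ≠ 0) (h : Fin N → G) :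
    S.IsAveraging ρ (S.average ρ h) := by
  intro y
  rw [average_apply, Finset.smul_sum]
  refine (convex_convexHull ℝ _).sum_mem (fun _ _ => by positivity) (by simp [hN]) fun j _ =>
    subset_convexHull ℝ _ ⟨S.lam ρ (h j), Subgroup.subset_closure ⟨_, rfl⟩, rfl⟩

open Classical in
theorem norm_average_le {N : ℕ} (h : Fin N → G) {F : Set G} (T : Fin N → Set G) {K : ℕ}
    (hT : ∀ j, ∀ g ∈ F, ∀ t, t ∉ T j → h j * g * (h j)⁻¹ * t ∈ T j)
    (hK : ∀ t, (Finset.univ.filter fun j => t ∈ T j).card ≤ K)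
    {x : L2 G H →L[ℂ] L2 G H} (hx : x ∈ S.supportedOn ρ F) :
    ‖S.average ρ h x‖ ≤ (N : ℝ)⁻¹ * (2 * ‖x‖ * √(N * K)) := by
  have hr : ∀ y : L2 G H →L[ℂ] L2 G H, ‖(N : ℝ)⁻¹ • y‖ = (N : ℝ)⁻¹ * ‖y‖ := by
    intro y
    have hc : (N : ℝ)⁻¹ • y = (N : ℂ)⁻¹ • y := by
      ext ξ t
      change (N : ℝ)⁻¹ • y ξ t = (N : ℂ)⁻¹ • y ξ t
      rw [← Complex.coe_smul, Complex.ofReal_inv, Complex.ofReal_natCast]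
    rw [hc, norm_smul, norm_inv, Complex.norm_natCast]
  rw [average_apply, hr]
  refine mul_le_mul_of_nonneg_left ?_ (by positivity)
  have := norm_sum_le_of_corner_eq_zero ρ
    (fun j => S.lamOp ρ (h j) * x * star (S.lamOp ρ (h j))) T (C := ‖x‖) (K := K)
    (fun j => norm_conj_unitary_le ρ (S.lam ρ (h j)) x) (norm_nonneg _) (fun j => ?_) hK
  · simpa using this
  -- Largeness of `T j` says exactly that the conjugated support moves the complement of `T j` off
  -- itself.
  · refine restrict_mul_mul_restrict (S := S) ρ
      (F := {g' | ∃ g ∈ F, g' = h j * g * (h j)⁻¹}) ?_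
      (lamOp_conj_mem_supportedOn ρ _ (fun g hg => Set.mem_ofPred_eq ▸ ⟨g, hg, rfl⟩) hx)
    rintro _ ⟨g, hg, rfl⟩ t ht
    simpa using hT j g hg t ht

-- The overlap bound `K` is fixed while `N` is free, so the estimate `2 ‖x‖ √(K / N)` can be made
-- arbitrarily small.
open Classical in
theorem exists_norm_average_le {F X : Set G} {K : ℕ} (hK0 : K ≠ 0)
    (hF : ∀ N : ℕ, ∃ (h : Fin N → G) (T : Fin N → Set G), (∀ j, h j ∈ X) ∧
      (∀ j, ∀ g ∈ F, ∀ t, t ∉ T j → h j * g * (h j)⁻¹ * t ∈ T j) ∧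
      ∀ t, (Finset.univ.filter fun j => t ∈ T j).card ≤ K)
    {x : L2 G H →L[ℂ] L2 G H} (hx : x ∈ S.supportedOn ρ F) {ε : ℝ} (hε : 0 < ε) :
    ∃ (N : ℕ) (h : Fin N → G), N ≠ 0 ∧ (∀ j, h j ∈ X) ∧ ‖S.average ρ h x‖ ≤ ε := by
  obtain ⟨m, hm⟩ := exists_nat_gt (2 * ‖x‖ / ε)
  have hm0 : (0 : ℝ) < m := lt_of_le_of_lt (by positivity) hm
  -- With `N = K m²` the root `√(N K)` is the integer `K m`, and the bound becomes `2 ‖x‖ / m < ε`.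
  obtain ⟨h, T, hX, hT, hK⟩ := hF (K * m ^ 2)
  have hm1 : m ≠ 0 := by exact_mod_cast hm0.ne'
  refine ⟨K * m ^ 2, h, by positivity, hX, (norm_average_le ρ h T hT hK hx).trans ?_⟩
  have hs : √(((K * m ^ 2 : ℕ) : ℝ) * K) = K * m := by
    rw [show ((K * m ^ 2 : ℕ) : ℝ) * K = (K * m) ^ 2 by push_cast; ring]
    exact Real.sqrt_sq (by positivity)
  have hK1 : (K : ℝ) ≠ 0 := by exact_mod_cast hK0
  have : (((K * m ^ 2 : ℕ) : ℝ))⁻¹ * (2 * ‖x‖ * (K * m)) = 2 * ‖x‖ / m := by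
    push_cast
    field_simp
  rw [hs, this, div_le_iff₀ hm0]
  rw [div_lt_iff₀ hε] at hm
  linarith

/-! ### Groups with property (P_com) -/

theorem exists_isAveraging_of_hasPCom (hG : HasPCom G) {F : Set G} (hF : F.Finite)
    (hne : F.Nonempty) (h1 : (1 : G) ∉ F) {x : L2 G H →L[ℂ] L2 G H}
    (hx : x ∈ S.supportedOn ρ F) {ε : ℝ} (hε : 0 < ε) :
    ∃ Φ, S.IsAveraging ρ Φ ∧ ‖Φ x‖ ≤ ε := by
  classical
  obtain ⟨n, g₀, U, D, hUD, hU, hD⟩ := hG F hF hne h1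
  -- The overlap is in fact at most `n`; `n + 1` is used to have a nonzero bound.
  suffices hF' : ∀ N : ℕ, ∃ (h : Fin N → G) (T : Fin N → Set G), (∀ j, h j ∈ Set.univ) ∧
      (∀ j, ∀ g ∈ F, ∀ t, t ∉ T j → h j * g * (h j)⁻¹ * t ∈ T j) ∧
      ∀ t, (Finset.univ.filter fun j => t ∈ T j).card ≤ n + 1 by
    obtain ⟨N, h, hN, -, hle⟩ := exists_norm_average_le ρ n.succ_ne_zero hF' hx hε
    exact ⟨_, isAveraging_average ρ hN h, hle⟩
  intro N
  -- Here `T j` is the complement of `g₀ ^ j U`, and its largeness is the condition `g U ∩ U = ∅`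
  -- translated by `g₀ ^ j`.
  refine ⟨fun j => g₀ ^ (j : ℕ), fun j => {t | (g₀ ^ (j : ℕ))⁻¹ * t ∉ U}, fun _ => trivial,
    fun j g hg t ht => ?_, fun t => ?_⟩
  · simp only [Set.mem_ofPred_eq, not_not] at ht ⊢
    have := hU g hg _ ht
    simpa only [mul_assoc, inv_mul_cancel_left] using this
  -- If `t ∈ T j`, then `g₀⁻ʲ t` lies in some `D k`. Two indices `i < j` cannot share `k`, since `g₀
  -- ^ (i - j)` would then map a point of `D k` into `D k`. So `j ↦ k` is injective.
  · choose k hk using hUD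
    have hinj : Function.Injective
        fun j : {j : Fin N // t ∈ {t | (g₀ ^ (j : ℕ))⁻¹ * t ∉ U}} => k _ j.2 := by
      have key : ∀ i j : {j : Fin N // t ∈ {t | (g₀ ^ (j : ℕ))⁻¹ * t ∉ U}},
          (i : ℕ) < j → k _ i.2 ≠ k _ j.2 := by
        intro i j hij he
        refine hD (j - i) (by omega) (k _ i.2) _ (hk _ i.2) ?_
        rw [← mul_assoc, ← mul_inv_rev, ← pow_add, Nat.add_sub_cancel' hij.le, he]
        exact hk _ j.2
      intro i j he
      rcases lt_trichotomy (i : ℕ) j with hij | hij | hij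
      · exact absurd he (key i j hij)
      · exact Subtype.ext (Fin.ext hij)
      · exact absurd he.symm (key j i hij)
    have := Fintype.card_le_of_injective _ hinj
    rw [Fintype.card_subtype, Fintype.card_fin] at this
    refine le_trans (le_of_eq ?_) (this.trans n.le_succ)
    congr

/-! ### PH groups -/

theorem exists_norm_average_le_of_isPowersSet {F X : Set G} (hX : IsPowersSet X F)
    {x : L2 G H →L[ℂ] L2 G H} (hx : x ∈ S.supportedOn ρ F) {ε : ℝ} (hε : 0 < ε) :
    ∃ (N : ℕ) (h : Fin N → G), N ≠ 0 ∧ (∀ j, h j ∈ X) ∧ ‖S.average ρ h x‖ ≤ ε := by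
  classical
  refine exists_norm_average_le ρ one_ne_zero (fun N => ?_) hx hε
  obtain ⟨h, T, hX, hd, hT⟩ := hX N
  refine ⟨h, T, hX, fun j g hg t ht => hT j _ ⟨g, hg, rfl⟩ t ht, fun t => ?_⟩
  rw [Finset.card_le_one]
  intro i hi j hj
  by_contra hij
  exact Set.disjoint_left.1 (hd hij) (Finset.mem_filter.1 hi).2 (Finset.mem_filter.1 hj).2

theorem average_mem_supportedOn_conjugatesBy {N : ℕ} (h : Fin N → G) {f : G} {M : Set G}
    {x : L2 G H →L[ℂ] L2 G H} (hx : x ∈ S.supportedOn ρ (conjugatesBy f M)) :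
    S.average ρ h x ∈ S.supportedOn ρ (conjugatesBy f (Set.image2 (· * ·) (Set.range h) M)) := by
  rw [average_apply]
  refine Submodule.smul_of_tower_mem _ _ (Submodule.sum_mem _ fun j _ =>
    lamOp_conj_mem_supportedOn ρ _ ?_ hx)
  rintro _ ⟨m, hm, rfl⟩
  exact ⟨h j * m, ⟨h j, ⟨j, rfl⟩, m, hm, rfl⟩, by simp only [mul_assoc, mul_inv_rev]⟩

/-- Induction on the number of pieces, for arbitrary finite sets `M j` of conjugators: averaging
away the first piece enlarges the conjugator sets of the others, so the statement for `M j = {1}`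
alone would not be inductive. -/
theorem exists_isAveraging_of_isCPowersSet {ε : ℝ} (hε : 0 < ε) {n : ℕ} {f : Fin n → G}
    {K : Fin n → Subgroup G} (hK : Monotone K) (hf : ∀ j, IsCPowersSet (K j : Set G) (f j))
    {M : Fin n → Set G} (hM : ∀ j, (M j).Finite) (hne : ∀ j, (M j).Nonempty)
    (hMK : ∀ j, M j ⊆ K j) {x : Fin n → (L2 G H →L[ℂ] L2 G H)}
    (hx : ∀ j, x j ∈ S.supportedOn ρ (conjugatesBy (f j) (M j))) :
    ∃ Φ, S.IsAveraging ρ Φ ∧ ∀ j, ‖Φ (x j)‖ ≤ ε := by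
  induction n with
  | zero => exact ⟨_, isAveraging_id ρ, fun j => j.elim0⟩
  | succ n ih =>
    obtain ⟨N, h, hN, hhK, hle⟩ := exists_norm_average_le_of_isPowersSet ρ
      (hf 0 (M 0) (hM 0) (hne 0) (hMK 0)) (hx 0) hε
    have : NeZero N := ⟨hN⟩
    obtain ⟨Φ, hΦ, hΦx⟩ := ih (f := fun j => f j.succ) (K := fun j => K j.succ)
      (hK.comp (Fin.strictMono_succ).monotone) (fun j => hf j.succ)
      (M := fun j => Set.image2 (· * ·) (Set.range h) (M j.succ))
      (fun j => (Set.finite_range h).image2 _ (hM j.succ))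
      (fun j => (Set.range_nonempty h).image2 (hne j.succ))
      (fun j => by
        rintro _ ⟨_, ⟨i, rfl⟩, m, hm, rfl⟩
        -- The averaging elements come from `K 0`, which monotonicity places in every later
        -- subgroup.
        exact mul_mem (hK (Fin.zero_le j.succ) (hhK i)) (hMK j.succ hm))
      (x := fun j => S.average ρ h (x j.succ))
      (fun j => average_mem_supportedOn_conjugatesBy ρ h (hx j.succ))
    refine ⟨Φ ∘ₗ S.average ρ h, hΦ.comp ρ (isAveraging_average ρ hN h), fun j => ?_⟩
    refine Fin.cases ?_ (fun j => ?_) j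
    · exact (hΦ.norm_apply_le ρ _).trans hle
    · exact hΦx j

theorem exists_isAveraging_of_isPHGroup (hG : IsPHGroup G) {F : Set G} (hF : F.Finite)
    (hne : F.Nonempty) (h1 : (1 : G) ∉ F) {x : L2 G H →L[ℂ] L2 G H}
    (hx : x ∈ S.supportedOn ρ F) {ε : ℝ} (hε : 0 < ε) :
    ∃ Φ, S.IsAveraging ρ Φ ∧ ‖Φ x‖ ≤ ε := by
  obtain ⟨n, f, K, rfl, hK, hf⟩ := hG F hF hne h1
  -- The enumeration `f` may repeat elements; each generator is assigned to one index that
  -- represents its group element.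
  have hsum : ∃ z : Fin n → (L2 G H →L[ℂ] L2 G H),
      (∀ j, z j ∈ S.supportedOn ρ (conjugatesBy (f j) {1})) ∧ ∑ j, z j = x := by
    classical
    induction hx using Submodule.span_induction with
    | mem x hx =>
      obtain ⟨a, _, ⟨j, rfl⟩, rfl⟩ := hx
      refine ⟨Pi.single j (S.piOp ρ a * S.lamOp ρ (f j)), fun i => ?_, by simp⟩
      by_cases hij : i = j
      · subst hij
        rw [Pi.single_eq_same]
        exact Submodule.subset_span ⟨a, f i, ⟨1, rfl, by simp⟩, rfl⟩
      · rw [Pi.single_eq_of_ne hij]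
        exact zero_mem _
    | zero => exact ⟨0, fun j => zero_mem _, by simp⟩
    | add x y _ _ hx hy =>
      obtain ⟨z, hz, rfl⟩ := hx
      obtain ⟨w, hw, rfl⟩ := hy
      exact ⟨z + w, fun j => add_mem (hz j) (hw j), by simp [Finset.sum_add_distrib]⟩
    | smul c x _ hx =>
      obtain ⟨z, hz, rfl⟩ := hx
      exact ⟨c • z, fun j => Submodule.smul_mem _ _ (hz j), by simp [Finset.smul_sum]⟩
  obtain ⟨z, hz, rfl⟩ := hsum
  have hn : 0 < n := by
    obtain ⟨_, j, rfl⟩ := hne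
    exact j.pos
  have hn' : (0 : ℝ) < n := by exact_mod_cast hn
  obtain ⟨Φ, hΦ, hle⟩ := exists_isAveraging_of_isCPowersSet ρ (div_pos hε hn') hK hf
    (M := fun _ => {1}) (fun _ => Set.finite_singleton _) (fun _ => Set.singleton_nonempty _)
    (fun j => by simp) hz
  refine ⟨Φ, hΦ, ?_⟩
  rw [map_sum]
  refine (norm_sum_le_of_le _ fun j _ => hle j).trans ?_
  rw [Finset.sum_const, Finset.card_univ, Fintype.card_fin, nsmul_eq_mul, mul_div_cancel₀ _ hn'.ne']

/-! ### Approximation by finitely supported elements -/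

theorem norm_compress_le (T : L2 G H →L[ℂ] L2 G H) : ‖compress G H T‖ ≤ ‖T‖ := by
  classical
  refine ContinuousLinearMap.opNorm_le_bound _ (norm_nonneg _) fun v => ?_
  change ‖T (lp.single 2 1 v) 1‖ ≤ _
  refine (lp.norm_apply_le_norm (by norm_num) _ _).trans ((T.le_opNorm _).trans ?_)
  rw [lp.norm_single (by norm_num)]

theorem norm_piOp_le (a : A) : ‖S.piOp ρ a‖ ≤ ‖a‖ :=
  NonUnitalStarAlgHom.norm_apply_le (S.piHom ρ) a

/-- This separates the coefficient at the identity, the one that `E` detects, from the part that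
averaging can kill. -/
theorem exists_eq_piOp_add_of_mem_finiteSums {x : L2 G H →L[ℂ] L2 G H}
    (hx : x ∈ S.finiteSums ρ) : ∃ (a : A) (F : Set G) (z : L2 G H →L[ℂ] L2 G H),
      F.Finite ∧ (1 : G) ∉ F ∧ z ∈ S.supportedOn ρ F ∧ x = S.piOp ρ a + z := by
  have h0 : S.piOp ρ 0 = 0 := map_zero (S.piHom ρ)
  induction hx using Submodule.span_induction with
  | mem x hx =>
    obtain ⟨a, g, rfl⟩ := hx
    by_cases hg : g = 1
    · exact ⟨a, ∅, 0, Set.finite_empty, by simp, zero_mem _, by rw [hg, lamOp_one]; simp⟩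
    · exact ⟨0, {g}, _, Set.finite_singleton _, fun h => hg h.symm,
        Submodule.subset_span ⟨a, g, rfl, rfl⟩, by rw [h0, zero_add]⟩
  | zero => exact ⟨0, ∅, 0, Set.finite_empty, by simp, zero_mem _, by rw [h0, zero_add]⟩
  | add x y _ _ hx hy =>
    obtain ⟨a, F, z, hF, hF1, hz, rfl⟩ := hx
    obtain ⟨b, F', w, hF', hF1', hw, rfl⟩ := hy
    refine ⟨a + b, F ∪ F', z + w, hF.union hF', by simp [hF1, hF1'],
      add_mem (supportedOn_mono ρ Set.subset_union_left hz)
        (supportedOn_mono ρ Set.subset_union_right hw), ?_⟩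
    rw [show S.piOp ρ (a + b) = S.piOp ρ a + S.piOp ρ b from map_add (S.piHom ρ) a b]
    abel
  | smul c x _ hx =>
    obtain ⟨a, F, z, hF, hF1, hz, rfl⟩ := hx
    refine ⟨c • a, F, c • z, hF, hF1, Submodule.smul_mem _ _ hz, ?_⟩
    rw [show S.piOp ρ (c • a) = c • S.piOp ρ a from map_smul (S.piHom ρ) c a, smul_add]

theorem compress_eq_zero_of_mem_supportedOn {F : Set G} (hF : (1 : G) ∉ F)
    {z : L2 G H →L[ℂ] L2 G H} (hz : z ∈ S.supportedOn ρ F) : compress G H z = 0 := by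
  classical
  induction hz using Submodule.span_induction with
  | mem z hz =>
    obtain ⟨a, g, hg, rfl⟩ := hz
    rw [compress_piOp_mul_lamOp, if_neg (by rintro rfl; exact hF hg), map_zero]
  | zero => exact map_zero _
  | add x y _ _ hx hy => rw [map_add, hx, hy, add_zero]
  | smul c x _ hx => rw [map_smul, hx, smul_zero]

theorem compress_piOp (a : A) : compress G H (S.piOp ρ a) = ρ a := by
  classical
  have := S.compress_piOp_mul_lamOp ρ a 1
  rwa [lamOp_one, mul_one, if_pos rfl] at this

theorem exists_supportedOn_norm_sub_le (hρ : Function.Injective ρ) (y : S.redCrossedProduct ρ)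
    (hy : S.condExp ρ hρ y = 0) {ε : ℝ} (hε : 0 < ε) :
    ∃ (F : Set G) (z : L2 G H →L[ℂ] L2 G H), F.Finite ∧ (1 : G) ∉ F ∧ z ∈ S.supportedOn ρ F ∧
      ‖(y : L2 G H →L[ℂ] L2 G H) - z‖ ≤ ε := by
  have hcl : (y : L2 G H →L[ℂ] L2 G H) ∈ closure
      (StarAlgebra.adjoin ℂ (Set.range (S.piOp ρ) ∪ Set.range (S.lamOp ρ)) :
        Set (L2 G H →L[ℂ] L2 G H)) := y.2
  obtain ⟨x, hx, hyx⟩ := Metric.mem_closure_iff.1 hcl (ε / 2) (half_pos hε)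
  rw [dist_eq_norm] at hyx
  obtain ⟨a, F, z, hF, hF1, hz, rfl⟩ :=
    exists_eq_piOp_add_of_mem_finiteSums ρ (S.adjoin_subset_finiteSums ρ hx)
  refine ⟨F, z, hF, hF1, hz, ?_⟩
  -- Compression is contractive, kills `y` and `z`, and sends `π(a)` to `ρ a`, whose norm is `‖a‖`;
  -- so the identity coefficient is itself within the approximation error.
  have ha : ‖a‖ ≤ ε / 2 := by
    have h := norm_compress_le ((y : L2 G H →L[ℂ] L2 G H) - (S.piOp ρ a + z))
    rw [map_sub, ← S.ρ_condExp ρ hρ, hy, map_zero, map_add, compress_piOp,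
      compress_eq_zero_of_mem_supportedOn ρ hF1 hz, add_zero, zero_sub, norm_neg,
      StarAlgHom.norm_map_of_injective ρ hρ] at h
    exact h.trans hyx.le
  calc ‖(y : L2 G H →L[ℂ] L2 G H) - z‖
      = ‖((y : L2 G H →L[ℂ] L2 G H) - (S.piOp ρ a + z)) + S.piOp ρ a‖ := by congr 1; abel
    _ ≤ ε / 2 + ε / 2 := norm_add_le_of_le hyx.le ((norm_piOp_le ρ a).trans ha)
    _ = ε := add_halves ε

theorem exists_isAveraging (hG : IsPHGroup G ∨ HasPCom G) {F : Set G} (hF : F.Finite)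
    (h1 : (1 : G) ∉ F) {x : L2 G H →L[ℂ] L2 G H}
    (hx : x ∈ S.supportedOn ρ F) {ε : ℝ} (hε : 0 < ε) :
    ∃ Φ, S.IsAveraging ρ Φ ∧ ‖Φ x‖ ≤ ε := by
  -- Both group conditions concern nonempty sets only; for empty support `x = 0`.
  rcases F.eq_empty_or_nonempty with rfl | hne
  · have hx0 : x = 0 := by simpa [supportedOn] using hx
    exact ⟨_, isAveraging_id ρ, by simpa [hx0] using hε.le⟩
  · rcases hG with hG | hG
    · exact exists_isAveraging_of_isPHGroup ρ hG hF hne h1 hx hε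
    · exact exists_isAveraging_of_hasPCom ρ hG hF hne h1 hx hε

theorem zero_mem_closure_convexHull (hG : IsPHGroup G ∨ HasPCom G) (hρ : Function.Injective ρ)
    (y : S.redCrossedProduct ρ) (hy : S.condExp ρ hρ y = 0) :
    (0 : S.redCrossedProduct ρ) ∈ closure (convexHull ℝ
      {x | ∃ v ∈ S.lamGroup ρ,
        x = (v : S.redCrossedProduct ρ) * y * star (v : S.redCrossedProduct ρ)}) := by
  rw [Metric.mem_closure_iff]
  intro ε hε
  obtain ⟨F, z, hF, hF1, hz, hyz⟩ :=
    exists_supportedOn_norm_sub_le ρ hρ y hy (show 0 < ε / 3 by positivity)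
  obtain ⟨Φ, hΦ, hle⟩ := exists_isAveraging ρ hG hF hF1 hz (show 0 < ε / 3 by positivity)
  -- The averaging maps live on all bounded operators; `ι` carries the convex hull back into the
  -- crossed product.
  let ι : S.redCrossedProduct ρ →ₗ[ℝ] (L2 G H →L[ℂ] L2 G H) :=
    (S.redCrossedProduct ρ).toSubalgebra.toSubmodule.subtype.restrictScalars ℝ
  have himg : S.lamOrbit ρ y = ι '' {x | ∃ v ∈ S.lamGroup ρ,
      x = (v : S.redCrossedProduct ρ) * y * star (v : S.redCrossedProduct ρ)} := by
    ext x
    constructor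
    · rintro ⟨v, hv, rfl⟩
      exact ⟨_, ⟨v, hv, rfl⟩, rfl⟩
    · rintro ⟨_, ⟨v, hv, rfl⟩, rfl⟩
      exact ⟨v, hv, rfl⟩
  have hmem := hΦ (y : L2 G H →L[ℂ] L2 G H)
  rw [himg, ← LinearMap.image_convexHull] at hmem
  obtain ⟨w, hw, hwy⟩ := hmem
  refine ⟨w, hw, ?_⟩
  rw [dist_zero_left]
  change ‖ι w‖ < ε
  -- The error `y - z` stays below `ε / 3` by contractivity and the average of `z` is at most `ε /
  -- 3`.
  rw [hwy, show (y : L2 G H →L[ℂ] L2 G H) = (y - z) + z by abel, map_add]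
  have := norm_add_le_of_le ((hΦ.norm_apply_le ρ _).trans hyz) hle
  linarith

end

end TwistedAction

theorem theorem3p8 {A G H : Type*} [CStarAlgebra A] [Group G]
    [NormedAddCommGroup H] [InnerProductSpace ℂ H] [CompleteSpace H]
    (hG : IsPHGroup G ∨ HasPCom G)
    (S : TwistedAction A G)
    (ρ : A →⋆ₐ[ℂ] (H →L[ℂ] H)) (hρ : Function.Injective ρ) :
    S.HasDP ρ hρ ∧ S.HasStrongDP ρ hρ := by
  have h : S.HasStrongDP ρ hρ := fun y _ hy =>
    TwistedAction.zero_mem_closure_convexHull ρ hG hρ y hy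
  refine ⟨fun y hs hy => closure_mono (convexHull_mono ?_) (h y hs hy), h⟩
  rintro _ ⟨v, -, rfl⟩
  exact ⟨v, rfl⟩
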